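/- Let $K$ be a field, $L/K$ a cyclic Galois extension of degree $n$, $\sigma$ a generator of $\mathrm{Gal}(L/K)$, $N$ the norm map from $L$ to $K$, and let $R=L[x;\sigma]$ be the skew polynomial ring, whose elements are the polynomials $\sum_i a_i x^i$ with $a_i\in L$ and whose multiplication is determined by $xa=\sigma(a)x$ for $a\in L$. Let $F\in K[y]$ be a monic irreducible polynomial of degree $s$ with constant coefficient $F_0$, put $E=K[y]/(F)$ and $R_F=R/RF(x^n)$ (the element $F(x^n)$ is central in $R$), and regard $R_F$ as an $E$-algebra, the class of $g(y)$ acting as that of $g(x^n)$. (0) If $K$ is finite and $F\neq y$, then $R_F$ is isomorphic to $M_n(E)$ as an $E$-algebra. Now let $K$ be arbitrary again, suppose that $R_F\cong M_n(E)$ as $E$-algebras, and let $\varphi:R_F\to M_n(E)$ be any $E$-algebra isomorphism. For $a\in R$ let $\mathrm{rank}(a)$ be the rank of the matrix $\varphi(a+RF(x^n))$. Let $k\ge 0$ be an integer and let $a=\sum_i a_ix^i\in R$ be nonzero of degree at most $sk$. Then: (1) $\mathrm{rank}(a)\ge n-k$; (2) if $\mathrm{rank}(a)=n-k$, then $a_{sk}\neq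 0$ and $$\frac{N(a_0)}{N(a_{sk})}=(-1)^{sk(n-1)}F_0^{\,k}.$$ -/

import Mathlib

/-! Skew polynomial rings `L[x;σ]` and the quotients `L[x;σ] / (F(x^n))`. -/

section SkewPoly

variable {K L : Type*} [Field K] [Field L] [Algebra K L]

/-- The action of `ℕ` (written multiplicatively) on `L` in which `i` acts as `σ ^ i`. -/
@[reducible] def skewAction (σ : L ≃ₐ[K] L) : MulSemiringAction (Multiplicative ℕ) L :=
  MulSemiringAction.compHom L (powersHom (L ≃ₐ[K] L) σ)

/-- The skew polynomial ring `L[x;σ]`: polynomials `∑ aᵢ xⁱ` with coefficients in `L` written on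
the left, and multiplication determined by `x a = σ(a) x`. -/
def SkewPolyRing (_σ : L ≃ₐ[K] L) : Type _ := SkewPolynomial L

namespace SkewPolyRing

noncomputable instance instRing (σ : L ≃ₐ[K] L) : Ring (SkewPolyRing σ) :=
  letI := skewAction σ
  inferInstanceAs (Ring (SkewPolynomial L))

/-- The coefficient of `xⁱ`. -/
def coeff {σ : L ≃ₐ[K] L} (a : SkewPolyRing σ) (i : ℕ) : L :=
  SkewPolynomial.coeff (R := L) a i

/-- The degree of a skew polynomial, with `deg 0 = ⊥`. -/
def degree {σ : L ≃ₐ[K] L} (a : SkewPolyRing σ) : WithBot ℕ :=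
  (SkewPolynomial.support (R := L) a).max

/-- Constant skew polynomials. -/
noncomputable def C (σ : L ≃ₐ[K] L) : L →+* SkewPolyRing σ :=
  letI := skewAction σ
  SkewPolynomial.CRingHom (R := L)

/-- The indeterminate `x`. -/
noncomputable def X (σ : L ≃ₐ[K] L) : SkewPolyRing σ := SkewPolynomial.X (R := L)

theorem X_mul_C (σ : L ≃ₐ[K] L) (a : L) : X σ * C σ a = C σ (σ a) * X σ := by
  let := skewAction σ
  have h : (SkewPolynomial.X * SkewPolynomial.C a : SkewPolynomial L)
      = SkewPolynomial.C (σ a) * SkewPolynomial.X := by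
    rw [← SkewPolynomial.monomial_zero_left, SkewPolynomial.X_mul_monomial,
      ← SkewPolynomial.monomial_zero_left, SkewPolynomial.monomial_mul_X]
    rfl
  exact h

theorem monomial_eq (σ : L ≃ₐ[K] L) (i : ℕ) (r : L) :
    (SkewPolynomial.monomial i r : SkewPolynomial L) = (show SkewPolynomial L from C σ r * X σ ^ i) := by
  let := skewAction σ
  have h : (SkewPolynomial.monomial i r : SkewPolynomial L)
      = SkewPolynomial.C r * SkewPolynomial.X ^ i := by
    rw [← SkewPolynomial.monomial_zero_left, SkewPolynomial.monomial_mul_X_pow, zero_add]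
  exact h

theorem X_pow_mul_C (σ : L ≃ₐ[K] L) (i : ℕ) (a : L) :
    X σ ^ i * C σ a = C σ ((σ ^ i) a) * X σ ^ i := by
  induction i generalizing a with
  | zero => simp
  | succ i ih =>
    rw [pow_succ, mul_assoc, X_mul_C, ← mul_assoc, ih, mul_assoc, ← pow_succ, pow_succ σ]
    rfl

/-- An element that commutes with the constants and with `x` is central. -/
theorem commute_of_commute {σ : L ≃ₐ[K] L} {z : SkewPolyRing σ}
    (hC : ∀ r, Commute z (C σ r)) (hX : Commute z (X σ)) (a : SkewPolyRing σ) : Commute z a := by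
  refine SkewPolynomial.induction (R := L) (motive := fun a => Commute z (show SkewPolyRing σ from a))
    a (Commute.zero_right z) ?_
  intro i r q _ _ hq
  have h : Commute z (show SkewPolyRing σ from SkewPolynomial.monomial i r) := by
    rw [monomial_eq σ i r]
    exact (hC r).mul_right (hX.pow_right i)
  exact Commute.add_right h hq

/-- The ring homomorphism `K[y] → L[x;σ]`, `g(y) ↦ g(xⁿ)`, with `n` the order of `σ`. -/
noncomputable def central (σ : L ≃ₐ[K] L) : Polynomial K →+* SkewPolyRing σ :=
  Polynomial.eval₂RingHom' ((C σ).comp (algebraMap K L)) (X σ ^ orderOf σ) fun c => by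
    have h := X_pow_mul_C σ (orderOf σ) (algebraMap K L c)
    rw [pow_orderOf_eq_one] at h
    exact h.symm

theorem central_commute (σ : L ≃ₐ[K] L) (g : Polynomial K) (a : SkewPolyRing σ) :
    Commute (central σ g) a := by
  have h1 : ∀ c : K, central σ (Polynomial.C c) = C σ (algebraMap K L c) := fun c =>
    Polynomial.eval₂_C _ _
  have h2 : central σ Polynomial.X = X σ ^ orderOf σ := Polynomial.eval₂_X _ _
  refine commute_of_commute (fun r => ?_) ?_ a
  · induction g using Polynomial.induction_on' with
    | add p q hp hq => rw [map_add]; exact hp.add_left hq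
    | monomial i c =>
      rw [← Polynomial.C_mul_X_pow_eq_monomial, map_mul, map_pow, h1, h2]
      refine Commute.mul_left ?_ (Commute.pow_left ?_ i)
      · change _ * _ = _ * _
        rw [← map_mul, mul_comm, map_mul]
      · change _ * _ = _ * _
        rw [X_pow_mul_C, pow_orderOf_eq_one]
        rfl
  · induction g using Polynomial.induction_on' with
    | add p q hp hq => rw [map_add]; exact hp.add_left hq
    | monomial i c =>
      rw [← Polynomial.C_mul_X_pow_eq_monomial, map_mul, map_pow, h1, h2]
      refine Commute.mul_left ?_ (((Commute.refl _).pow_left _).pow_left i)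
      change _ * _ = _ * _
      rw [X_mul_C, AlgEquiv.commutes]

/-- The left ideal `R F(xⁿ)` of `R = L[x;σ]`; it is two-sided because `F(xⁿ)` is central. -/
noncomputable abbrev idealOf (σ : L ≃ₐ[K] L) (F : Polynomial K) : Ideal (SkewPolyRing σ) :=
  Ideal.span {central σ F}

instance instIsTwoSided (σ : L ≃ₐ[K] L) (F : Polynomial K) : (idealOf σ F).IsTwoSided := by
  refine ⟨fun {a} b ha => ?_⟩
  obtain ⟨c, rfl⟩ := Ideal.mem_span_singleton'.1 ha
  rw [mul_assoc, (central_commute σ F b).eq, ← mul_assoc]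
  exact Ideal.mem_span_singleton'.2 ⟨_, rfl⟩

/-- The quotient ring `R_F = R / R F(xⁿ)`. -/
abbrev QuotRing (σ : L ≃ₐ[K] L) (F : Polynomial K) : Type _ := SkewPolyRing σ ⧸ idealOf σ F

/-- The image in `R_F` of a skew polynomial. -/
noncomputable abbrev toQuot (σ : L ≃ₐ[K] L) (F : Polynomial K) : SkewPolyRing σ →+* QuotRing σ F :=
  Ideal.Quotient.mk (idealOf σ F)

/-- The ring homomorphism `E = K[y]/(F) → R_F` sending the class of `g(y)` to that of `g(xⁿ)`. -/
noncomputable def scalarHom (σ : L ≃ₐ[K] L) (F : Polynomial K) : AdjoinRoot F →+* QuotRing σ F :=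
  Ideal.Quotient.lift (Ideal.span {F}) ((toQuot σ F).comp (central σ)) (by
    intro g hg
    obtain ⟨c, rfl⟩ := Ideal.mem_span_singleton'.1 hg
    rw [RingHom.comp_apply, map_mul]
    exact Ideal.Quotient.eq_zero_iff_mem.2 (Ideal.mem_span_singleton'.2 ⟨_, rfl⟩))

theorem scalarHom_mk (σ : L ≃ₐ[K] L) (F g : Polynomial K) :
    scalarHom σ F (AdjoinRoot.mk F g) = toQuot σ F (central σ g) := rfl

/-- `R_F` as an algebra over `E = K[y]/(F)`. -/
noncomputable instance instAlgebraQuot (σ : L ≃ₐ[K] L) (F : Polynomial K) :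
    Algebra (AdjoinRoot F) (QuotRing σ F) :=
  RingHom.toAlgebra' (scalarHom σ F) (by
    intro e b
    obtain ⟨g, rfl⟩ := AdjoinRoot.mk_surjective e
    obtain ⟨a, rfl⟩ := Ideal.Quotient.mk_surjective b
    rw [scalarHom_mk, ← map_mul, ← map_mul, (central_commute σ g a).eq])

end SkewPolyRing

end SkewPoly

/-! ### Semilinear maps: cyclic vectors and determinants. -/

section SemilinearDet

open Polynomial

/-! In `M_n(E)` the images `c l` of constants and `x` of the indeterminate satisfy the relations of
a cyclic algebra, with `x ^ n` equal to the root `y` of `F`. Let `A` be the image of `a`, of kernel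
dimension `k'` over `E`, and stack a basis of `ker A` into one vector `v` of `V = (E^n)^k'`. Then
`V` is an `L`-space through `c`, and `x` acts on it by a `σ`-semilinear map `f`. Matrices move a
linearly independent family to any family, and sums of `c l * x ^ i` give all matrices, so the
iterates of `v` span `V` over `L`. Since `A` kills the basis, `∑ a_i f^i v = 0`; hence `s k' = dim_L
V ≤ deg a ≤ s k`, which is the rank bound (`IsCyclicPair.rank_bound`). If `k' = k`, the first `sk`
iterates form a basis and the determinant of `f` over `K` is computed twice: as a companion map
composed with coordinatewise `σ` (`det_of_semilinear_relation`), and as `k` copies of `x`, with `det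
x = (-1)^(n-1) y` (`IsCyclicPair.det_eq`). Comparison gives the norm formula. For finite `K` and `y
≠ 0`, two-sided multiplications extract coefficients, so `R_F` is central simple over a finite
field, and Wedderburn's theorems make it a matrix algebra. -/

theorem AlgEquiv.orderOf_eq_finrank {K L : Type*} [Field K] [Field L] [Algebra K L]
    [FiniteDimensional K L] [IsGalois K L] (σ : L ≃ₐ[K] L)
    (hσ : ∀ τ : L ≃ₐ[K] L, τ ∈ Subgroup.zpowers σ) : orderOf σ = Module.finrank K L := by
  rw [orderOf_eq_card_of_forall_mem_zpowers hσ, IsGalois.card_aut_eq_finrank]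

/-- The minimal polynomial `X^n - 1` of `σ` already has degree `n`, so it is the characteristic
polynomial. -/
theorem AlgEquiv.det_eq_of_generator {K L : Type*} [Field K] [Field L] [Algebra K L]
    [FiniteDimensional K L] [IsGalois K L] (σ : L ≃ₐ[K] L)
    (hσ : ∀ τ : L ≃ₐ[K] L, τ ∈ Subgroup.zpowers σ) :
    LinearMap.det σ.toLinearMap = (-1) ^ (Module.finrank K L - 1) := by
  have hpos : 0 < Module.finrank K L := Module.finrank_pos
  have ho := σ.orderOf_eq_finrank hσ
  have hmin := minpoly_algEquiv_toLinearMap σ (isOfFinOrder_of_finite σ)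
  rw [ho] at hmin
  have hchar : σ.toLinearMap.charpoly = X ^ Module.finrank K L - C 1 := by
    rw [← hmin]
    refine (Polynomial.eq_of_monic_of_dvd_of_natDegree_le (minpoly.monic (Algebra.IsIntegral.isIntegral σ.toLinearMap))
      (LinearMap.charpoly_monic _) (LinearMap.minpoly_dvd_charpoly _) ?_)
    rw [LinearMap.charpoly_natDegree, hmin, natDegree_X_pow_sub_C]
  rw [LinearMap.det_eq_sign_charpoly_coeff, hchar]
  obtain ⟨m, hm⟩ := Nat.exists_eq_succ_of_ne_zero hpos.ne'
  rw [hm]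
  simp [pow_succ]

variable {K L V : Type*} [Field K] [Field L] [Algebra K L] [AddCommGroup V] [Module K V]
  [Module L V] [IsScalarTower K L V]

omit [IsScalarTower K L V] in
theorem semilinear_pow_smul {σ : L ≃ₐ[K] L} {f : V →ₗ[K] V} (hf : ∀ (l : L) w, f (l • w) = σ l • f w)
    (i : ℕ) (l : L) (w : V) : (f ^ i) (l • w) = (σ ^ i) l • (f ^ i) w := by
  induction i with
  | zero => simp
  | succ i ih => rw [pow_succ', pow_succ', Module.End.mul_apply, ih, hf]; rfl

omit [IsScalarTower K L V] in
/-- The iterates of a vector under a semilinear map all lie in the span of the first `d` ones, once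
there is a linear relation of degree `d` between them. -/
theorem span_iterates_eq_top {σ : L ≃ₐ[K] L} {f : V →ₗ[K] V}
    (hf : ∀ (l : L) w, f (l • w) = σ l • f w) {v : V}
    (hv : Submodule.span L (Set.range fun i : ℕ => (f ^ i) v) = ⊤) {d : ℕ} {a : ℕ → L}
    (had : a d ≠ 0) (ha : ∑ i ∈ Finset.range (d + 1), a i • (f ^ i) v = 0) :
    Submodule.span L (Set.range fun i : Fin d => (f ^ (i : ℕ)) v) = ⊤ := by
  rw [eq_top_iff, ← hv, Submodule.span_le]
  rintro _ ⟨m, rfl⟩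
  induction m using Nat.strong_induction_on with
  | _ m ih =>
    by_cases hm : m < d
    · exact Submodule.subset_span ⟨⟨m, hm⟩, rfl⟩
    · obtain ⟨j, rfl⟩ := Nat.exists_eq_add_of_le (not_lt.1 hm)
      -- Applying `f ^ j` turns the leading coefficient into `(σ ^ j) (a d)`, still nonzero, so the
      -- top iterate can be solved for.
      have h := congrArg (f ^ j) ha
      rw [map_sum, map_zero, Finset.sum_range_succ] at h
      simp only [semilinear_pow_smul hf, ← Module.End.mul_apply, ← pow_add] at h
      have hne : (σ ^ j) (a d) ≠ 0 := (_root_.map_ne_zero _).2 had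
      have h2 := eq_neg_of_add_eq_zero_right h
      have h3 : (f ^ (d + j)) v ∈ Submodule.span L (Set.range fun i : Fin d => (f ^ (i : ℕ)) v) := by
        rw [← Submodule.smul_mem_iff _ hne, add_comm d j, h2]
        refine Submodule.neg_mem _ (Submodule.sum_mem _ fun i hi => Submodule.smul_mem _ _ ?_)
        have := Finset.mem_range.1 hi
        exact ih (j + i) (by omega)
      exact h3

/-- Determinant of a linear map that shifts a basis and ends with a relation. -/
theorem LinearMap.det_of_shift {d : ℕ} (b : Module.Basis (Fin d) L V) (T : V →ₗ[L] V) (w : ℕ → V)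
    (hw : ∀ i : Fin d, w i = b i) (hT : ∀ i : Fin d, T (b i) = w (i + 1)) (a : ℕ → L)
    (ha : w d = - ∑ i ∈ Finset.range d, a i • w i) :
    d = 0 ∨ LinearMap.det T = (-1) ^ d * a 0 := by
  -- For `d = 0` the determinant is 1 while `a 0` is unconstrained, hence the disjunction.
  rcases Nat.eq_zero_or_pos d with h0 | hd
  · exact Or.inl h0
  right
  have hdeg : (∑ i ∈ Finset.range d, C (a i) * X ^ i : L[X]).degree < d := by
    rw [Finset.sum_range]
    exact degree_sum_fin_lt _
  set p : L[X] := X ^ d + ∑ i ∈ Finset.range d, C (a i) * X ^ i with hp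
  have hmon : p.Monic := monic_X_pow_add hdeg
  have hnat : p.natDegree = d := natDegree_eq_of_degree_eq_some (by
    rw [hp, degree_add_eq_left_of_degree_lt (by rwa [degree_X_pow]), degree_X_pow])
  -- `T` is conjugate to multiplication by the root on `L[X]/(p)`, so its determinant is the norm of
  -- that root.
  let pb := AdjoinRoot.powerBasis' hmon
  have hgen : pb.gen = AdjoinRoot.root p := rfl
  have hdim : pb.dim = d := hnat
  let e : AdjoinRoot p ≃ₗ[L] V := pb.basis.equiv b (finCongr hdim)
  have he : ∀ i < d, e (AdjoinRoot.root p ^ i) = w i := by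
    intro i hi
    have : e (pb.basis ⟨i, hdim.symm ▸ hi⟩) = b ⟨i, hi⟩ := by
      rw [Module.Basis.equiv_apply]
      rfl
    rw [pb.basis_eq_pow, hgen] at this
    rw [this, ← hw]
  have hroot : AdjoinRoot.root p ^ d = - ∑ i ∈ Finset.range d, a i • AdjoinRoot.root p ^ i := by
    have h := AdjoinRoot.mk_self (f := p)
    rw [hp, map_add, map_pow, map_sum, AdjoinRoot.mk_X] at h
    rw [eq_neg_iff_add_eq_zero, ← h]
    congr 1
    refine Finset.sum_congr rfl fun i _ => ?_
    rw [map_mul, map_pow, AdjoinRoot.mk_X, AdjoinRoot.mk_C, Algebra.smul_def]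
    rfl
  have he' : e (AdjoinRoot.root p ^ d) = w d := by
    rw [hroot, ha, map_neg, map_sum]
    congr 1
    refine Finset.sum_congr rfl fun i hi => ?_
    rw [map_smul, he i (Finset.mem_range.1 hi)]
  have hconj : T = (e : AdjoinRoot p →ₗ[L] V) ∘ₗ (Algebra.lmul L _ (AdjoinRoot.root p)) ∘ₗ
      (e.symm : V →ₗ[L] AdjoinRoot p) := by
    refine b.ext fun i => ?_
    have h1 : e.symm (b i) = AdjoinRoot.root p ^ (i : ℕ) := by
      rw [LinearEquiv.symm_apply_eq, he i i.2, hw]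
    rw [hT, LinearMap.comp_apply, LinearMap.comp_apply, LinearEquiv.coe_coe, LinearEquiv.coe_coe, h1]
    change _ = e (AdjoinRoot.root p * AdjoinRoot.root p ^ (i : ℕ))
    rw [← pow_succ']
    rcases Nat.lt_or_ge (i + 1) d with h | h
    · exact (he _ h).symm
    · have : (i : ℕ) + 1 = d := by omega
      rw [this, he']
  rw [hconj, LinearMap.det_conj]
  change Algebra.norm L (AdjoinRoot.root p) = _
  rw [← hgen, Algebra.PowerBasis.norm_gen_eq_coeff_zero_minpoly, hgen, hdim, AdjoinRoot.minpoly_root hmon.ne_zero,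
    hmon.leadingCoeff, hp]
  simp [hd.ne, coeff_X_pow, hd.ne']

omit [IsScalarTower K L V] in
theorem finrank_le_of_semilinear_relation {σ : L ≃ₐ[K] L} {f : V →ₗ[K] V}
    (hf : ∀ (l : L) w, f (l • w) = σ l • f w) {v : V}
    (hv : Submodule.span L (Set.range fun i : ℕ => (f ^ i) v) = ⊤) {d : ℕ} {a : ℕ → L}
    (had : a d ≠ 0) (ha : ∑ i ∈ Finset.range (d + 1), a i • (f ^ i) v = 0) :
    Module.finrank L V ≤ d := by
  have h := span_iterates_eq_top hf hv had ha
  rw [← finrank_top, ← h]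
  exact (finrank_range_le_card _).trans_eq (Fintype.card_fin d)

/-- In the basis of iterates, `f` is coordinatewise `σ` followed by an `L`-linear companion map `T`.
Over `K` the two factors have determinants `det(σ)^d` and the norm of `det T`. -/
theorem det_of_semilinear_relation [FiniteDimensional K L] [IsGalois K L] {σ : L ≃ₐ[K] L}
    (hσ : ∀ τ : L ≃ₐ[K] L, τ ∈ Subgroup.zpowers σ) {f : V →ₗ[K] V}
    (hf : ∀ (l : L) w, f (l • w) = σ l • f w) {v : V}
    (hv : Submodule.span L (Set.range fun i : ℕ => (f ^ i) v) = ⊤) {d : ℕ} {a : ℕ → L}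
    (had : a d ≠ 0) (ha : ∑ i ∈ Finset.range (d + 1), a i • (f ^ i) v = 0)
    (hd : Module.finrank L V = d) :
    LinearMap.det f = Algebra.norm K ((-1) ^ d * (a 0 / a d)) *
      (-1) ^ ((Module.finrank K L - 1) * d) := by
  have h := span_iterates_eq_top hf hv had ha
  let b : Module.Basis (Fin d) L V := basisOfTopLeSpanOfCardEqFinrank _ h.ge (by simp [hd])
  have hb : ∀ i : Fin d, b i = (f ^ (i : ℕ)) v := fun i => by
    simp [b]
  let T : V →ₗ[L] V := b.constr L fun i => f (b i)
  have hT : ∀ i, T (b i) = f (b i) := fun i => b.constr_basis L _ i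
  let S₀ : (Fin d → L) →ₗ[K] (Fin d → L) :=
    LinearMap.pi fun i => σ.toLinearMap ∘ₗ LinearMap.proj i
  let e : (Fin d → L) ≃ₗ[K] V := b.equivFun.symm.restrictScalars K
  have hfac : f = T.restrictScalars K ∘ₗ
      ((e : (Fin d → L) →ₗ[K] V) ∘ₗ S₀ ∘ₗ (e.symm : V →ₗ[K] (Fin d → L))) := by
    ext w
    obtain ⟨c, rfl⟩ := e.surjective w
    have he : ∀ c, e c = ∑ i, c i • b i := fun c => b.equivFun_symm_apply c
    simp only [LinearMap.comp_apply, LinearEquiv.coe_coe, LinearEquiv.symm_apply_apply,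
      LinearMap.restrictScalars_apply]
    rw [he, he, map_sum, map_sum]
    refine Finset.sum_congr rfl fun i _ => ?_
    rw [hf, map_smul, hT]
    rfl
  have hS : LinearMap.det S₀ = (-1) ^ ((Module.finrank K L - 1) * d) := by
    rw [LinearMap.det_pi, Finset.prod_const, AlgEquiv.det_eq_of_generator σ hσ, ← pow_mul]
    simp
  have hTd : Algebra.norm K (LinearMap.det T) = Algebra.norm K ((-1) ^ d * (a 0 / a d)) := by
    rcases LinearMap.det_of_shift b T (fun i => (f ^ i) v) (fun i => (hb i).symm)
      (fun i => by rw [hT, hb, pow_succ']; rfl) (fun i => a i / a d) (by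
        rw [Finset.sum_range_succ] at ha
        have h2 := eq_neg_of_add_eq_zero_right ha
        rw [← smul_right_injective V had |>.eq_iff]
        simp only [smul_neg, Finset.smul_sum, smul_smul, mul_div_cancel₀ _ had]
        exact h2) with h0 | h1
    -- Here `a 0` and `a d` coincide, so their quotient is 1.
    · subst h0
      have : LinearMap.det T = 1 := by
        rw [LinearMap.det_eq_one_of_finrank_eq_zero hd]
      rw [this, div_self had]
      simp
    · rw [h1]
  conv_lhs => rw [hfac]
  rw [LinearMap.det_comp, LinearMap.det_conj, hS, LinearMap.det_restrictScalars, hTd]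

end SemilinearDet

/-! ### Cyclic algebras: extraction of coefficients, simplicity, centre. -/

section CrossedProduct

/-- Wedderburn–Artin gives `M_m(D)`. The finite division ring `D` is commutative, so its scalar
matrices are central and `D = E`; dimensions give `m = n`. -/
theorem exists_algEquiv_matrix_of_isSimpleRing_of_center {E B : Type*} [Field E] [Finite E] [Ring B]
    [Algebra E B] [Module.Finite E B] [IsSimpleRing B] (n : ℕ) (hdim : Module.finrank E B = n ^ 2)
    (hcenter : ∀ b : B, (∀ b', b * b' = b' * b) → ∃ t : E, b = algebraMap E B t) :
    Nonempty (B ≃ₐ[E] Matrix (Fin n) (Fin n) E) := by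
  have : IsArtinianRing B := IsArtinianRing.of_finite E B
  obtain ⟨m, hm, D, _, _, _, ⟨e⟩⟩ := IsSimpleRing.exists_algEquiv_matrix_divisionRing_finite E B
  have : Finite D := Module.finite_of_finite E
  have hcomm : ∀ d d' : D, d * d' = d' * d := (Finite.isDomain_to_isField D).mul_comm
  have hsurj : Function.Surjective (Algebra.ofId E D) := by
    intro d
    obtain ⟨t, ht⟩ := hcenter (e.symm (Matrix.scalar _ d)) (by
      intro b'
      apply e.injective
      rw [map_mul, map_mul, AlgEquiv.apply_symm_apply]
      exact Matrix.scalar_commute d (fun r => hcomm d r) _)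
    refine ⟨t, ?_⟩
    rw [AlgEquiv.symm_apply_eq, AlgEquiv.commutes] at ht
    have h0 := congrFun (congrFun ht 0) 0
    simpa [Matrix.algebraMap_matrix_apply, Algebra.ofId_apply] using h0.symm
  let g : E ≃ₐ[E] D := AlgEquiv.ofBijective (Algebra.ofId E D) ⟨(Algebra.ofId E D).toRingHom.injective, hsurj⟩
  let e' : B ≃ₐ[E] Matrix (Fin m) (Fin m) E := e.trans g.symm.mapMatrix
  have hmn : m = n := by
    have h := e'.toLinearEquiv.finrank_eq
    rw [hdim, Module.finrank_matrix, Module.finrank_self] at h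
    simp only [Fintype.card_fin, mul_one, ← sq] at h
    exact (Nat.pow_left_injective two_ne_zero h).symm
  subst hmn
  exact ⟨e'⟩

variable {K L : Type*} [Field K] [Field L] [Algebra K L] [FiniteDimensional K L]

/-- By Dedekind's independence of automorphisms the matrix `(σ^i b_j)` is invertible; `u` is column
`m` of its inverse and `v` is the basis `b`. -/
theorem exists_dual_families (σ : L ≃ₐ[K] L) (m : Fin (orderOf σ))
    (ho : orderOf σ = Module.finrank K L) :
    ∃ u v : Fin (Module.finrank K L) → L, ∀ i : Fin (orderOf σ),
      ∑ j, u j * (σ ^ (i : ℕ)) (v j) = if i = m then 1 else 0 := by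
  classical
  let b := Module.finBasis K L
  let M : Matrix (Fin (orderOf σ)) (Fin (orderOf σ)) L :=
    fun i j => (σ ^ (i : ℕ)) (b (finCongr ho j))
  have hinj : Function.Injective fun i : Fin (orderOf σ) => ((σ ^ (i : ℕ) : L ≃ₐ[K] L) : L →ₐ[K] L) := by
    intro i j hij
    have h : σ ^ (i : ℕ) = σ ^ (j : ℕ) := AlgEquiv.coe_toAlgHom_injective hij
    exact Fin.ext (pow_injOn_Iio_orderOf (Set.mem_Iio.2 i.2) (Set.mem_Iio.2 j.2) h)
  have hM : IsUnit M := by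
    rw [← Matrix.linearIndependent_rows_iff_isUnit]
    rw [Fintype.linearIndependent_iff]
    intro g hg
    have hli := (linearIndependent_algHom_toLinearMap K L L).comp _ hinj
    refine Fintype.linearIndependent_iff.1 hli g ?_
    refine b.ext fun j => ?_
    have := congrFun hg ((finCongr ho).symm j)
    simpa [M, Matrix.row, Finset.sum_apply, LinearMap.sum_apply] using this
  refine ⟨fun j => M⁻¹ ((finCongr ho).symm j) m, b, fun i => ?_⟩
  have h := congrFun (congrFun (Matrix.mul_nonsing_inv M ((Matrix.isUnit_iff_isUnit_det _).1 hM)) i) m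
  rw [Matrix.mul_apply, Matrix.one_apply] at h
  rw [← h, ← Equiv.sum_comp (finCongr ho)]
  exact Finset.sum_congr rfl fun j _ => by simp [M, mul_comm]

theorem sum_range_pow_eq_trace [IsGalois K L] (σ : L ≃ₐ[K] L)
    (hσ : ∀ τ : L ≃ₐ[K] L, τ ∈ Subgroup.zpowers σ) (l : L) :
    ∑ i : Fin (orderOf σ), (σ ^ (i : ℕ)) l = algebraMap K L (Algebra.trace K L l) := by
  rw [trace_eq_sum_automorphisms]
  refine Fintype.sum_bijective (fun i : Fin (orderOf σ) => σ ^ (i : ℕ)) ⟨?_, ?_⟩ _ _ fun _ => rfl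
  · intro i j h
    exact Fin.ext (pow_injOn_Iio_orderOf (Set.mem_Iio.2 i.2) (Set.mem_Iio.2 j.2) h)
  · intro τ
    obtain ⟨k, hk⟩ := (mem_powers_iff_mem_zpowers).2 (hσ τ)
    exact ⟨⟨k % orderOf σ, Nat.mod_lt _ (orderOf_pos σ)⟩, by
      simpa [pow_mod_orderOf] using hk⟩

variable {E B : Type*} [Field E] [Algebra K E] [Ring B] [Algebra E B]

/-- The relations of a cyclic algebra: a copy of `L` and an element `x` inducing `σ` on it, whose
`n`-th power is a scalar `y`. -/
structure IsCyclicPair (σ : L ≃ₐ[K] L) (c : L →+* B) (x : B) (y : E) : Prop where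
  map_algebraMap : ∀ r : K, c (algebraMap K L r) = algebraMap E B (algebraMap K E r)
  mul_map : ∀ l : L, x * c l = c (σ l) * x
  pow_orderOf : x ^ orderOf σ = algebraMap E B y

namespace IsCyclicPair

variable {σ : L ≃ₐ[K] L} {c : L →+* B} {x : B} {y : E}

omit [FiniteDimensional K L] in
theorem pow_mul_map (h : IsCyclicPair σ c x y) (i : ℕ) (l : L) :
    x ^ i * c l = c ((σ ^ i) l) * x ^ i := by
  induction i generalizing l with
  | zero => simp
  | succ i ih =>
    rw [pow_succ, mul_assoc, h.mul_map, ← mul_assoc, ih, mul_assoc, ← pow_succ, pow_succ σ]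
    rfl

/-- Isolate one term of a polynomial in `x` of degree less than `n`. -/
theorem exists_projection (h : IsCyclicPair σ c x y) (ho : orderOf σ = Module.finrank K L)
    (m : Fin (orderOf σ)) :
    ∃ u v : Fin (Module.finrank K L) → L, (∀ i : Fin (orderOf σ),
      ∑ j, u j * (σ ^ (i : ℕ)) (v j) = if i = m then 1 else 0) ∧
      ∀ z : Fin (orderOf σ) → B, (∀ i l, Commute (z i) (c l)) →
        ∑ j, c (u j) * (∑ i, z i * x ^ (i : ℕ)) * c (v j) = z m * x ^ (m : ℕ) := by
  classical
  obtain ⟨u, v, huv⟩ := exists_dual_families σ m ho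
  refine ⟨u, v, huv, fun z hz => ?_⟩
  simp only [Finset.mul_sum, Finset.sum_mul]
  rw [Finset.sum_comm]
  -- Moving `c (v j)` left across `x ^ i` twists it by `σ ^ i`, and duality then kills every `i ≠
  -- m`.
  have : ∀ i : Fin (orderOf σ), ∑ j, c (u j) * (z i * x ^ (i : ℕ)) * c (v j) =
      z i * c (∑ j, u j * (σ ^ (i : ℕ)) (v j)) * x ^ (i : ℕ) := by
    intro i
    rw [map_sum, Finset.mul_sum, Finset.sum_mul]
    refine Finset.sum_congr rfl fun j _ => ?_
    rw [map_mul, ← mul_assoc, ← (hz i _).eq, mul_assoc, h.pow_mul_map]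
    simp only [mul_assoc]
  simp only [this, huv]
  rw [Finset.sum_eq_single m (fun i _ hi => by simp [hi]) (fun hm => absurd (Finset.mem_univ _) hm)]
  simp

/-- This sends a constant to a scalar through its trace, without inverting `x`: the powers on the
two sides of `c l` add up to `n`. -/
theorem sum_conj [IsGalois K L] (h : IsCyclicPair σ c x y)
    (hσ : ∀ τ : L ≃ₐ[K] L, τ ∈ Subgroup.zpowers σ) (l : L) :
    ∑ i : Fin (orderOf σ), x ^ (i : ℕ) * c l * x ^ (orderOf σ - i) =
      algebraMap E B (y * algebraMap K E (Algebra.trace K L l)) := by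
  have : ∀ i : Fin (orderOf σ), x ^ (i : ℕ) * c l * x ^ (orderOf σ - i) =
      c ((σ ^ (i : ℕ)) l) * algebraMap E B y := by
    intro i
    rw [h.pow_mul_map, mul_assoc, ← pow_add, Nat.add_sub_cancel' i.2.le, h.pow_orderOf]
  simp only [this]
  rw [← Finset.sum_mul, ← map_sum, sum_range_pow_eq_trace σ hσ, h.map_algebraMap, mul_comm y, map_mul]

omit [FiniteDimensional K L] [Algebra K E] in
theorem commute_span (e : Fin (Module.finrank K L) → E) (b : Fin (Module.finrank K L) → L) (l : L) :
    Commute (∑ j, e j • c (b j)) (c l) := by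
  refine Commute.sum_left _ _ _ fun j _ => Commute.smul_left ?_ _
  change _ * _ = _ * _
  rw [← map_mul, mul_comm, map_mul]

/-- Recover a coefficient of an element of a cyclic algebra by two-sided multiplications. -/
theorem exists_sandwich [IsGalois K L] (h : IsCyclicPair σ c x y)
    (hσ : ∀ τ : L ≃ₐ[K] L, τ ∈ Subgroup.zpowers σ)
    (b : Module.Basis (Fin (Module.finrank K L)) K L)
    (m : Fin (orderOf σ)) (l : L) :
    ∃ u v : Fin (Module.finrank K L) → L, (∀ i : Fin (orderOf σ),
      ∑ j, u j * (σ ^ (i : ℕ)) (v j) = if i = m then 1 else 0) ∧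
      ∀ e : Fin (orderOf σ) → Fin (Module.finrank K L) → E,
      ∑ i : Fin (orderOf σ), x ^ (i : ℕ) * ((∑ j, c (u j) *
        (∑ i, ∑ j, e i j • (c (b j) * x ^ (i : ℕ))) * c (v j)) * x ^ (orderOf σ - m) * c l) *
          x ^ (orderOf σ - i) =
        algebraMap E B (y * y * ∑ j, e m j * algebraMap K E (Algebra.trace K L (b j * l))) := by
  obtain ⟨u, v, huv, hproj⟩ := h.exists_projection (σ.orderOf_eq_finrank hσ) m
  refine ⟨u, v, huv, fun e => ?_⟩
  have hz : (∑ i : Fin (orderOf σ), ∑ j, e i j • (c (b j) * x ^ (i : ℕ))) =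
      ∑ i, (∑ j, e i j • c (b j)) * x ^ (i : ℕ) := by
    refine Finset.sum_congr rfl fun i _ => ?_
    rw [Finset.sum_mul]
    exact Finset.sum_congr rfl fun j _ => (smul_mul_assoc _ _ _).symm
  rw [hz, hproj _ fun i l => commute_span _ _ l]
  -- The factor `x ^ (n - m)` completes `x ^ m` to the scalar `y`, leaving a combination of
  -- constants to which `sum_conj` applies.
  have h1 : (∑ j, e m j • c (b j)) * x ^ (m : ℕ) * x ^ (orderOf σ - m) * c l =
      ∑ j, (y * e m j) • c (b j * l) := by
    rw [mul_assoc _ (x ^ _) (x ^ _), ← pow_add, Nat.add_sub_cancel' m.2.le, h.pow_orderOf,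
      ← Algebra.commutes y, ← Algebra.smul_def, smul_mul_assoc, Finset.sum_mul, Finset.smul_sum]
    refine Finset.sum_congr rfl fun j _ => ?_
    rw [map_mul, smul_mul_assoc, smul_smul]
  simp only [h1]
  simp only [Finset.mul_sum, Finset.sum_mul, mul_smul_comm, smul_mul_assoc]
  rw [Finset.sum_comm]
  simp only [← Finset.smul_sum, h.sum_conj hσ]
  simp only [Algebra.smul_def, ← map_mul]
  rw [← map_sum]
  congr 1
  exact Finset.sum_congr rfl fun j _ => by ring

theorem exists_traceDual [IsGalois K L] (b : Module.Basis (Fin (Module.finrank K L)) K L)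
    (j₀ : Fin (Module.finrank K L)) (e : Fin (Module.finrank K L) → E) :
    ∃ l : L, ∑ j, e j * algebraMap K E (Algebra.trace K L (b j * l)) = e j₀ := by
  classical
  refine ⟨b.traceDual j₀, ?_⟩
  rw [Finset.sum_eq_single j₀]
  · rw [mul_comm (b j₀), b.trace_traceDual_mul]; simp
  · intro j _ hj
    rw [mul_comm (b j), b.trace_traceDual_mul]; simp [hj]
  · intro hm; exact absurd (Finset.mem_univ _) hm

/-- Sandwiching a relation, with `l` chosen from the trace-dual basis, isolates each coefficient
times `y * y`. -/
theorem linearIndependent [IsGalois K L] [Nontrivial B] (h : IsCyclicPair σ c x y)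
    (hσ : ∀ τ : L ≃ₐ[K] L, τ ∈ Subgroup.zpowers σ) (hy : y ≠ 0)
    (b : Module.Basis (Fin (Module.finrank K L)) K L) :
    LinearIndependent E fun p : Fin (orderOf σ) × Fin (Module.finrank K L) =>
      c (b p.2) * x ^ (p.1 : ℕ) := by
  rw [Fintype.linearIndependent_iff]
  rintro e he ⟨m, j₀⟩
  obtain ⟨l, hl⟩ := exists_traceDual b j₀ fun j => e (m, j)
  obtain ⟨u, v, -, hs⟩ := h.exists_sandwich hσ b m l
  have h1 := hs fun i j => e (i, j)
  rw [Fintype.sum_prod_type] at he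
  rw [he, hl] at h1
  have h2 : y * y * e (m, j₀) = 0 := by
    apply (algebraMap E B).injective
    rw [← h1]; simp
  simpa [hy] using h2

/-- The sandwich stays inside a two-sided ideal and turns a nonzero element into a nonzero scalar,
which is a unit. -/
theorem eq_top_of_isTwoSided [IsGalois K L] (h : IsCyclicPair σ c x y)
    (hσ : ∀ τ : L ≃ₐ[K] L, τ ∈ Subgroup.zpowers σ) (hy : y ≠ 0)
    (b : Module.Basis (Fin (Module.finrank K L)) K L)
    (hspan : ∀ w : B, ∃ e : Fin (orderOf σ) → Fin (Module.finrank K L) → E,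
      w = ∑ i, ∑ j, e i j • (c (b j) * x ^ (i : ℕ)))
    (I : Ideal B) [I.IsTwoSided] {w : B} (hw : w ∈ I) (hw0 : w ≠ 0) : I = ⊤ := by
  obtain ⟨e, rfl⟩ := hspan w
  obtain ⟨m, j₀, hm⟩ : ∃ m j₀, e m j₀ ≠ 0 := by
    by_contra! H
    exact hw0 (by simp [H])
  obtain ⟨l, hl⟩ := exists_traceDual b j₀ (e m)
  obtain ⟨u, v, -, hs⟩ := h.exists_sandwich hσ b m l
  have h1 := hs e
  rw [hl] at h1
  have hmem : algebraMap E B (y * y * e m j₀) ∈ I := by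
    rw [← h1]
    refine Submodule.sum_mem _ fun i _ => I.mul_mem_right _ (I.mul_mem_left _ (I.mul_mem_right _
      (I.mul_mem_right _ (Submodule.sum_mem _ fun j _ => I.mul_mem_right _ (I.mul_mem_left _ hw)))))
  exact Ideal.eq_top_of_isUnit_mem _ hmem
    ((IsUnit.mk0 _ (mul_ne_zero (mul_ne_zero hy hy) hm)).map (algebraMap E B))

theorem exists_algebraMap_of_central [IsGalois K L] (h : IsCyclicPair σ c x y)
    (hσ : ∀ τ : L ≃ₐ[K] L, τ ∈ Subgroup.zpowers σ) (hy : y ≠ 0)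
    (b : Module.Basis (Fin (Module.finrank K L)) K L)
    (hspan : ∀ w : B, ∃ e : Fin (orderOf σ) → Fin (Module.finrank K L) → E,
      w = ∑ i, ∑ j, e i j • (c (b j) * x ^ (i : ℕ)))
    (w : B) (hw : ∀ w', w * w' = w' * w) : ∃ t : E, w = algebraMap E B t := by
  obtain ⟨l, hl⟩ := Algebra.trace_surjective K L 1
  obtain ⟨e, he⟩ := hspan w
  obtain ⟨u, v, huv, hs⟩ := h.exists_sandwich hσ b ⟨0, orderOf_pos σ⟩ l
  have h1 := hs e
  rw [← he] at h1
  -- A central `w` is fixed by the projection for `m = 0`, since `∑ u_j v_j = 1`. With `l` of trace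
  -- 1 the whole sandwich becomes `y * y * w`, yet it is a scalar.
  have h0 : ∑ j, c (u j) * w * c (v j) = w := by
    have := huv ⟨0, orderOf_pos σ⟩
    rw [if_pos rfl] at this
    simp only [pow_zero, AlgEquiv.one_apply] at this
    simp only [← hw, mul_assoc]
    rw [← Finset.mul_sum]
    simp only [← map_mul, ← map_sum, this, map_one, mul_one]
  rw [h0] at h1
  have h2 : ∀ i : Fin (orderOf σ), x ^ (i : ℕ) * (w * x ^ (orderOf σ - 0) * c l) * x ^ (orderOf σ - i)
      = algebraMap E B y * w * (x ^ (i : ℕ) * c l * x ^ (orderOf σ - i)) := by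
    intro i
    rw [Nat.sub_zero, h.pow_orderOf, ← Algebra.commutes]
    simp only [mul_assoc]
    rw [← mul_assoc (x ^ (i : ℕ)) (algebraMap E B y), ← Algebra.commutes, mul_assoc,
      ← mul_assoc _ w, ← hw]
    simp only [mul_assoc]
  simp only [h2] at h1
  rw [← Finset.mul_sum, h.sum_conj hσ, hl, map_one, mul_one] at h1
  refine ⟨y⁻¹ * y⁻¹ * (y * y * ∑ j, e ⟨0, orderOf_pos σ⟩ j *
    algebraMap K E (Algebra.trace K L (b j * l))), ?_⟩
  have hyy : y⁻¹ * y⁻¹ * y * y = 1 := by field_simp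
  rw [map_mul, ← h1, mul_assoc (algebraMap E B y), ← Algebra.commutes y w, ← mul_assoc, ← mul_assoc,
    ← map_mul, ← map_mul, hyy, map_one, one_mul]

end IsCyclicPair
end CrossedProduct

/-! ### Determinant of `x` and the rank bound in a matrix algebra. -/

section RankBound

variable {K L E : Type*} [Field K] [Field L] [Algebra K L] [FiniteDimensional K L]
  [Field E] [Algebra K E] {n : ℕ} {σ : L ≃ₐ[K] L} {c : L →+* Matrix (Fin n) (Fin n) E}
  {x : Matrix (Fin n) (Fin n) E} {y : E}

theorem IsCyclicPair.det_eq [IsGalois K L] (h : IsCyclicPair σ c x y)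
    (hσ : ∀ τ : L ≃ₐ[K] L, τ ∈ Subgroup.zpowers σ) (hn : Module.finrank K L = n) :
    x.det = (-1) ^ (n - 1) * y := by
  have ho : orderOf σ = n := (σ.orderOf_eq_finrank hσ).trans hn
  have hpos : 0 < n := ho ▸ orderOf_pos σ
  have : Nonempty (Fin n) := ⟨⟨0, hpos⟩⟩
  have hxn : x ^ n = algebraMap E _ y := by
    have := h.pow_orderOf
    rwa [ho] at this
  have hdeg : x.charpoly.natDegree = n := by
    rw [Matrix.charpoly_natDegree_eq_dim, Fintype.card_fin]
  obtain ⟨u, v, -, hproj⟩ := h.exists_projection (σ.orderOf_eq_finrank hσ) ⟨0, orderOf_pos σ⟩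
  -- These are the coefficients of `charpoly - (X^n - y)`, which vanishes at `x` and has degree
  -- below `n`; projecting to index 0 isolates its constant term.
  have h1 := hproj (fun i => algebraMap E _ (x.charpoly.coeff i + if (i : ℕ) = 0 then y else 0))
    fun i l => Algebra.commutes _ _
  have h0 : ∑ i : Fin (orderOf σ), algebraMap E (Matrix (Fin n) (Fin n) E)
      (x.charpoly.coeff i + if (i : ℕ) = 0 then y else 0) * x ^ (i : ℕ) = 0 := by
    have hch := Matrix.aeval_self_charpoly x
    have hlead : x.charpoly.coeff n = 1 := by
      have := x.charpoly_monic.coeff_natDegree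
      rwa [hdeg] at this
    rw [Polynomial.aeval_eq_sum_range, hdeg, Finset.sum_range_succ, hlead, one_smul] at hch
    rw [Fin.sum_univ_eq_sum_range (fun i => algebraMap E (Matrix (Fin n) (Fin n) E)
      (x.charpoly.coeff i + if i = 0 then y else 0) * x ^ i), ho]
    simp only [map_add, add_mul]
    rw [Finset.sum_add_distrib, ← hch]
    congr 1
    · exact Finset.sum_congr rfl fun i _ => (Algebra.smul_def _ _).symm
    · rw [Finset.sum_eq_single 0]
      · rw [if_pos rfl, pow_zero, mul_one, hxn]
      · intro i _ hi
        simp [hi]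
      · intro hm
        exact absurd (Finset.mem_range.2 hpos) hm
  rw [h0] at h1
  have h2 : algebraMap E (Matrix (Fin n) (Fin n) E) (x.charpoly.coeff 0 + y) = 0 := by
    simpa using h1.symm
  have h3 : x.charpoly.coeff 0 = -y :=
    eq_neg_of_add_eq_zero_left ((map_eq_zero (algebraMap E (Matrix (Fin n) (Fin n) E))).1 h2)
  rw [Matrix.det_eq_sign_charpoly_coeff, h3, Fintype.card_fin]
  obtain ⟨m, rfl⟩ := Nat.exists_eq_succ_of_ne_zero hpos.ne'
  simp [pow_succ]

theorem IsCyclicPair.rank_bound [FiniteDimensional K E] [IsGalois K L] (h : IsCyclicPair σ c x y)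
    (hσ : ∀ τ : L ≃ₐ[K] L, τ ∈ Subgroup.zpowers σ) (hn : Module.finrank K L = n)
    (hgen : ∀ M : Matrix (Fin n) (Fin n) E,
      M ∈ AddSubmonoid.closure {M | ∃ (l : L) (i : ℕ), c l * x ^ i = M})
    {d : ℕ} {a : ℕ → L} (had : a d ≠ 0) :
    ∃ k : ℕ, (∑ i ∈ Finset.range (d + 1), c (a i) * x ^ i).rank + k = n ∧
      Module.finrank K E * k ≤ d ∧ (Module.finrank K E * k = d →
        Algebra.norm K ((-1) ^ d * (a 0 / a d)) * (-1) ^ ((n - 1) * d) =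
          Algebra.norm K (((-1) ^ (n - 1) * y) ^ k)) := by
  set A := ∑ i ∈ Finset.range (d + 1), c (a i) * x ^ i
  let k := Module.finrank E (LinearMap.ker A.mulVecLin)
  let q := Module.finBasis E (LinearMap.ker A.mulVecLin)
  have hrank : A.rank + k = n := by
    have := LinearMap.finrank_range_add_finrank_ker A.mulVecLin
    rwa [Module.finrank_fin_fun] at this
  let : Module L (Fin n → E) := Module.compHom (Fin n → E)
    ((Matrix.toLinAlgEquiv' : Matrix (Fin n) (Fin n) E ≃ₐ[E]
      Module.End E (Fin n → E)).toRingEquiv.toRingHom.comp c)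
  have hsmul : ∀ (l : L) (w : Fin n → E), l • w = (c l).mulVec w := fun l w => rfl
  have htower : IsScalarTower K L (Fin n → E) := ⟨fun r l w => by
    rw [hsmul, hsmul, Algebra.smul_def, map_mul, h.map_algebraMap, ← Algebra.smul_def,
      Matrix.smul_mulVec, algebraMap_smul]⟩
  let V := Fin k → (Fin n → E)
  let fE : V →ₗ[E] V := LinearMap.pi fun j => x.mulVecLin ∘ₗ LinearMap.proj j
  let f : V →ₗ[K] V := fE.restrictScalars K
  have hfapp : ∀ (w : V) j, f w j = x.mulVec (w j) := fun w j => rfl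
  -- The whole kernel basis is treated as one vector, so that a single cyclic vector generates `V`.
  let v : V := fun j => q j
  have hf : ∀ (l : L) (w : V), f (l • w) = σ l • f w := by
    intro l w
    funext j
    rw [hfapp, Pi.smul_apply, Pi.smul_apply, hsmul, hsmul, hfapp, Matrix.mulVec_mulVec,
      Matrix.mulVec_mulVec, h.mul_map]
  have hfpow : ∀ (i : ℕ) (w : V) j, (f ^ i) w j = (x ^ i).mulVec (w j) := by
    intro i
    induction i with
    | zero => intro w j; simp
    | succ i ih =>
      intro w j
      rw [pow_succ', Module.End.mul_apply, hfapp, ih, Matrix.mulVec_mulVec, ← pow_succ']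
  have hv : Submodule.span L (Set.range fun i : ℕ => (f ^ i) v) = ⊤ := by
    rw [eq_top_iff]
    rintro w -
    have hq : LinearIndependent E fun j => (q j : Fin n → E) :=
      q.linearIndependent.map' (LinearMap.ker A.mulVecLin).subtype (Submodule.ker_subtype _)
    -- Independence of the `q j` gives a matrix carrying them to the components of an arbitrary `w`.
    obtain ⟨g, hg⟩ := LinearMap.exists_extend
      ((Module.Basis.span hq).constr E w)
    have hgq : ∀ j, g (q j) = w j := by
      intro j
      have := LinearMap.congr_fun hg (Module.Basis.span hq j)
      rw [Module.Basis.constr_basis] at this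
      rw [← this, LinearMap.comp_apply, Submodule.subtype_apply, Module.Basis.span_apply]
    have hw : w = fun j => (LinearMap.toMatrix' g).mulVec (q j) := by
      funext j
      rw [← Matrix.toLin'_apply, Matrix.toLin'_toMatrix', hgq]
    rw [hw]
    have hM := hgen (LinearMap.toMatrix' g)
    generalize LinearMap.toMatrix' g = M at hM
    clear hw
    induction hM using AddSubmonoid.closure_induction with
    | mem M hM =>
      obtain ⟨l, i, rfl⟩ := hM
      have : (fun j => (c l * x ^ i).mulVec (q j : Fin n → E)) = l • (f ^ i) v := by
        funext j
        rw [Pi.smul_apply, hsmul, hfpow, Matrix.mulVec_mulVec]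
      rw [this]
      exact Submodule.smul_mem _ _ (Submodule.subset_span ⟨i, rfl⟩)
    | zero =>
      simp only [Matrix.zero_mulVec]
      exact Submodule.zero_mem _
    | add M N _ _ hM hN =>
      simp only [Matrix.add_mulVec]
      exact Submodule.add_mem _ hM hN
  have hrel : ∑ i ∈ Finset.range (d + 1), a i • (f ^ i) v = 0 := by
    funext j
    have hker : (∑ i ∈ Finset.range (d + 1), c (a i) * x ^ i).mulVec (q j : Fin n → E) = 0 :=
      LinearMap.mem_ker.1 (q j).2
    rw [Finset.sum_apply, Pi.zero_apply, ← hker, Matrix.sum_mulVec]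
    refine Finset.sum_congr rfl fun i _ => ?_
    rw [Pi.smul_apply, hsmul, hfpow, Matrix.mulVec_mulVec]
  have : FiniteDimensional K V := Module.Finite.trans E V
  have : FiniteDimensional L V := Module.Finite.of_restrictScalars_finite K L V
  -- The dimension over `K` is counted through `L` and through `E`; the factor `n` cancels.
  have hfin : Module.finrank L V = Module.finrank K E * k := by
    have h1 := Module.finrank_mul_finrank K L V
    have h2 := Module.finrank_mul_finrank K E V
    have h3 : Module.finrank E V = k * n := by
      rw [Module.finrank_pi_fintype]; simp
    have hpos : 0 < n := hn ▸ Module.finrank_pos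
    rw [h3] at h2
    rw [← h2, hn] at h1
    apply Nat.eq_of_mul_eq_mul_left hpos
    rw [h1]; ring
  refine ⟨k, hrank, hfin ▸ finrank_le_of_semilinear_relation hf hv had hrel, fun hd => ?_⟩
  have hdet := det_of_semilinear_relation hσ hf hv had hrel (hfin.trans hd)
  rw [hn] at hdet
  -- Over `E`, `f` is `k` copies of `x`; restricting scalars to `K` takes the norm of `det x ^ k`.
  rw [← hdet, LinearMap.det_restrictScalars, LinearMap.det_pi, Finset.prod_const, ← h.det_eq hσ hn]
  simp only [Finset.card_univ, Fintype.card_fin]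
  rw [← Matrix.toLin'_apply', LinearMap.det_toLin']

end RankBound

/-! ### The quotient `R_F` as a cyclic algebra over `E`. -/

namespace SkewPolyRing

variable {K L : Type*} [Field K] [Field L] [Algebra K L] (σ : L ≃ₐ[K] L)

theorem sum_C_coeff_mul_X_pow (a : SkewPolyRing σ) {d : ℕ} (hd : ∀ i, d < i → a.coeff i = 0) :
    a = ∑ i ∈ Finset.range (d + 1), C σ (a.coeff i) * X σ ^ i := by
  have h := SkewPolynomial.sum_eq_of_subset (R := L) (p := a) (S := SkewPolynomial L)
    (fun i r => SkewPolynomial.monomial i r) (fun i => SkewPolynomial.monomial_zero_right i)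
    (s := Finset.range (d + 1)) (by
      intro i hi
      rw [Finset.mem_range]
      by_contra hlt
      exact (SkewPolynomial.mem_support_iff.1 hi) (hd i (by omega)))
  refine ((SkewPolynomial.sum_monomial (R := L) a).symm.trans h).trans ?_
  exact Finset.sum_congr rfl fun i _ => monomial_eq σ i _

theorem mem_closure_C_mul_X_pow (a : SkewPolyRing σ) :
    a ∈ AddSubmonoid.closure {b | ∃ (l : L) (i : ℕ), C σ l * X σ ^ i = b} := by
  refine SkewPolynomial.induction (R := L) (motive := fun a =>
    (show SkewPolyRing σ from a) ∈ AddSubmonoid.closure {b | ∃ (l : L) (i : ℕ), C σ l * X σ ^ i = b})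
    a (AddSubmonoid.zero_mem _) ?_
  intro i r q _ _ hq
  refine AddSubmonoid.add_mem _ (x := (show SkewPolyRing σ from SkewPolynomial.monomial i r)) ?_ hq
  exact AddSubmonoid.subset_closure ⟨r, i, (monomial_eq σ i r).symm⟩

theorem central_C (r : K) : central σ (Polynomial.C r) = C σ (algebraMap K L r) :=
  Polynomial.eval₂_C _ _

theorem central_X : central σ Polynomial.X = X σ ^ orderOf σ :=
  Polynomial.eval₂_X _ _

/-- The faithful representation of `L[x;σ]` by polynomials over `End_K(L)`, with `x ↦ σ t`. -/
noncomputable def toEndPolynomial : SkewPolyRing σ →+* Polynomial (Module.End K L) :=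
  letI := skewAction σ
  SkewMonoidAlgebra.liftNCRingHom
    (Polynomial.C.comp (Algebra.lmul K L : L →+* Module.End K L))
    (powersHom (Polynomial (Module.End K L)) (Polynomial.monomial 1 σ.toLinearMap)) (by
      intro l i
      have hi : i • l = (σ ^ (Multiplicative.toAdd i)) l := rfl
      rw [hi, powersHom_apply, Polynomial.monomial_pow]
      simp only [RingHom.comp_apply, Polynomial.C_mul_monomial, Polynomial.monomial_mul_C]
      congr 1
      ext w
      simp [← AlgEquiv.pow_toLinearMap])

theorem toEndPolynomial_C (l : L) :
    toEndPolynomial σ (C σ l) = Polynomial.C (Algebra.lmul K L l) := by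
  let := skewAction σ
  refine (SkewMonoidAlgebra.liftNC_single _ _ _ _).trans ?_
  simp

theorem toEndPolynomial_X : toEndPolynomial σ (X σ) = Polynomial.monomial 1 σ.toLinearMap := by
  let := skewAction σ
  refine (SkewMonoidAlgebra.liftNC_single _ _ _ _).trans ?_
  simp only [toAdd_ofAdd, pow_one, powersHom_apply]
  exact (congrArg (· * _) (map_one (Polynomial.C.comp (Algebra.lmul K L : L →+* Module.End K L)))).trans
    (one_mul _)

theorem toEndPolynomial_central (F : Polynomial K) :
    toEndPolynomial σ (central σ F) =
      (Polynomial.expand K (orderOf σ) F).map (algebraMap K (Module.End K L)) := by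
  induction F using Polynomial.induction_on' with
  | add p q hp hq => rw [map_add, map_add, hp, hq, map_add, Polynomial.map_add]
  | monomial i r =>
    rw [← Polynomial.C_mul_X_pow_eq_monomial]
    simp only [map_mul, map_pow, central_C, central_X, toEndPolynomial_C, toEndPolynomial_X,
      Polynomial.expand_C, Polynomial.expand_X, Polynomial.map_mul, Polynomial.map_pow,
      Polynomial.map_C, Polynomial.map_X]
    have h1 : Algebra.lmul K L (algebraMap K L r) = algebraMap K (Module.End K L) r :=
      (Algebra.lmul K L).commutes r
    have h2 : (Polynomial.monomial 1 σ.toLinearMap) ^ orderOf σ =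
        (Polynomial.X ^ orderOf σ : Polynomial (Module.End K L)) := by
      rw [Polynomial.monomial_pow, ← AlgEquiv.pow_toLinearMap, pow_orderOf_eq_one, one_mul,
        Polynomial.X_pow_eq_monomial]
      rfl
    rw [h1, h2]

/-- In `End_K(L)[t]` the image of `F(x^n)` is monic of positive degree. Degrees add on multiplying
by a monic polynomial, even with zero divisors around, so no multiple of it is 1. -/
theorem nontrivial_quotRing {F : Polynomial K} (hF : F.Monic) (hirr : Irreducible F)
    (ho : 0 < orderOf σ) : Nontrivial (QuotRing σ F) := by
  refine Ideal.Quotient.nontrivial_iff.2 fun htop => ?_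
  obtain ⟨q, hq⟩ := Ideal.mem_span_singleton'.1 ((Ideal.eq_top_iff_one _).1 htop)
  have h := congrArg (toEndPolynomial σ) hq
  rw [map_mul, map_one, toEndPolynomial_central] at h
  have hmon := (hF.expand ho).map (algebraMap K (Module.End K L))
  have hdeg : ((Polynomial.expand K (orderOf σ) F).map
      (algebraMap K (Module.End K L))).natDegree ≠ 0 := by
    rw [(hF.expand ho).natDegree_map, Polynomial.natDegree_expand]
    exact (Nat.mul_pos hirr.natDegree_pos ho).ne'
  have hne : toEndPolynomial σ q ≠ 0 := by
    intro h0
    rw [h0, zero_mul] at h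
    exact zero_ne_one h
  have h3 := hmon.natDegree_mul' hne
  have h4 := congrArg Polynomial.natDegree h
  rw [Polynomial.natDegree_one, Polynomial.natDegree_mul' (by
    rw [hmon.leadingCoeff, mul_one]; exact Polynomial.leadingCoeff_ne_zero.2 hne)] at h4
  omega

/-- The images of the constants and of `x` in an algebra that `R_F` maps to. -/
theorem isCyclicPair {F : Polynomial K} [Fact (Irreducible F)] {B : Type*} [Ring B]
    [Algebra (AdjoinRoot F) B] (φ : QuotRing σ F →ₐ[AdjoinRoot F] B) :
    IsCyclicPair σ ((φ : QuotRing σ F →+* B).comp ((toQuot σ F).comp (C σ)))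
      (φ (toQuot σ F (X σ))) (AdjoinRoot.root F) where
  map_algebraMap r := by
    have h : toQuot σ F (C σ (algebraMap K L r)) =
        algebraMap (AdjoinRoot F) (QuotRing σ F) (algebraMap K (AdjoinRoot F) r) := by
      rw [← central_C]; rfl
    change φ (toQuot σ F (C σ (algebraMap K L r))) = _
    rw [h, φ.commutes]
  mul_map l := by
    change φ (toQuot σ F (X σ)) * φ (toQuot σ F (C σ l)) = φ (toQuot σ F (C σ (σ l))) * _
    rw [← map_mul, ← map_mul, X_mul_C, map_mul, map_mul]
  pow_orderOf := by
    have h : toQuot σ F (X σ ^ orderOf σ) =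
        algebraMap (AdjoinRoot F) (QuotRing σ F) (AdjoinRoot.root F) := by
      rw [← central_X]; rfl
    rw [← map_pow, ← map_pow, h, φ.commutes]

theorem exists_eq_sum_smul [FiniteDimensional K L] {F : Polynomial K} [Fact (Irreducible F)]
    (b : Module.Basis (Fin (Module.finrank K L)) K L) (w : QuotRing σ F) :
    ∃ e : Fin (orderOf σ) → Fin (Module.finrank K L) → AdjoinRoot F,
      w = ∑ i, ∑ j, e i j • (toQuot σ F (C σ (b j)) * toQuot σ F (X σ) ^ (i : ℕ)) := by
  have hp := isCyclicPair σ (AlgHom.id (AdjoinRoot F) (QuotRing σ F))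
  obtain ⟨a, rfl⟩ := Ideal.Quotient.mk_surjective w
  induction mem_closure_C_mul_X_pow σ a using AddSubmonoid.closure_induction with
  | mem a ha =>
    obtain ⟨l, i, rfl⟩ := ha
    -- Division of `i` by `n` splits `x ^ i` into a power of the scalar `x ^ n` and a remainder
    -- below `n`.
    let i₀ : Fin (orderOf σ) := ⟨i % orderOf σ, Nat.mod_lt _ (orderOf_pos σ)⟩
    refine ⟨fun i' j => if i' = i₀ then
      AdjoinRoot.root F ^ (i / orderOf σ) * algebraMap K (AdjoinRoot F) (b.repr l j) else 0, ?_⟩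
    rw [Finset.sum_eq_single i₀ (fun i' _ hi => by simp [hi])
      (fun hm => absurd (Finset.mem_univ _) hm)]
    have hl : toQuot σ F (C σ l) =
        ∑ j, algebraMap K (AdjoinRoot F) (b.repr l j) • toQuot σ F (C σ (b j)) := by
      conv_lhs => rw [← b.sum_repr l]
      rw [map_sum, map_sum]
      refine Finset.sum_congr rfl fun j _ => ?_
      rw [Algebra.smul_def, Algebra.smul_def, map_mul, map_mul]
      congr 1
      exact hp.map_algebraMap _
    have hx : toQuot σ F (X σ) ^ i =
        AdjoinRoot.root F ^ (i / orderOf σ) • toQuot σ F (X σ) ^ (i₀ : ℕ) := by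
      have := hp.pow_orderOf
      conv_lhs => rw [← Nat.div_add_mod i (orderOf σ), pow_add, pow_mul]
      rw [Algebra.smul_def, map_pow, ← this]
      rfl
    change toQuot σ F (C σ l * X σ ^ i) = _
    rw [map_mul, map_pow, hl, hx, Finset.sum_mul]
    refine Finset.sum_congr rfl fun j _ => ?_
    beta_reduce
    rw [if_pos rfl, smul_mul_smul_comm, mul_comm (algebraMap _ _ _)]
  | zero => exact ⟨0, by simp⟩
  | add a a' _ _ ha ha' =>
    obtain ⟨e, he⟩ := ha
    obtain ⟨e', he'⟩ := ha'
    refine ⟨e + e', ?_⟩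
    rw [map_add, he, he']
    simp only [Pi.add_apply, add_smul, Finset.sum_add_distrib]

theorem nonempty_algEquiv_matrix [FiniteDimensional K L] [IsGalois K L] [Finite K]
    (hσ : ∀ τ : L ≃ₐ[K] L, τ ∈ Subgroup.zpowers σ) {F : Polynomial K} (hF : F.Monic)
    (hirr : Irreducible F) (hFX : F ≠ Polynomial.X) :
    Nonempty (QuotRing σ F ≃ₐ[AdjoinRoot F]
      Matrix (Fin (Module.finrank K L)) (Fin (Module.finrank K L)) (AdjoinRoot F)) := by
  have : Fact (Irreducible F) := ⟨hirr⟩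
  have : Module.Finite K (AdjoinRoot F) := (AdjoinRoot.powerBasis hirr.ne_zero).finite
  have : Finite (AdjoinRoot F) := Module.finite_of_finite K
  have : Nontrivial (QuotRing σ F) := nontrivial_quotRing σ hF hirr (orderOf_pos σ)
  have hp := isCyclicPair σ (AlgHom.id (AdjoinRoot F) (QuotRing σ F))
  -- The only use of `F ≠ X`: it makes `x ^ n` an invertible scalar.
  have hy : AdjoinRoot.root F ≠ 0 := by
    intro h0
    rw [← AdjoinRoot.mk_X, AdjoinRoot.mk_eq_zero] at h0
    exact hFX (Polynomial.eq_of_monic_of_associated hF Polynomial.monic_X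
      (hirr.associated_of_dvd Polynomial.irreducible_X h0))
  let b := Module.finBasis K L
  have hspan := exists_eq_sum_smul σ (F := F) b
  have hli := hp.linearIndependent hσ hy b
  have htop : ⊤ ≤ Submodule.span (AdjoinRoot F) (Set.range
      fun p : Fin (orderOf σ) × Fin (Module.finrank K L) =>
        toQuot σ F (C σ (b p.2)) * toQuot σ F (X σ) ^ (p.1 : ℕ)) := by
    rintro w -
    obtain ⟨e, rfl⟩ := hspan w
    exact Submodule.sum_mem _ fun i _ => Submodule.sum_mem _ fun j _ =>
      Submodule.smul_mem _ _ (Submodule.subset_span ⟨(i, j), rfl⟩)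
  let B := Module.Basis.mk hli htop
  have : Module.Finite (AdjoinRoot F) (QuotRing σ F) := Module.Finite.of_basis B
  have : IsSimpleRing (QuotRing σ F) := isSimpleRing_iff_isTwoSided_imp.2
    ⟨inferInstance, fun I _ => by
      by_cases hI : I = ⊥
      · exact Or.inl hI
      · obtain ⟨w, hw, hw0⟩ := Submodule.exists_mem_ne_zero_of_ne_bot hI
        exact Or.inr (hp.eq_top_of_isTwoSided hσ hy b hspan I hw hw0)⟩
  refine exists_algEquiv_matrix_of_isSimpleRing_of_center _ ?_
    (hp.exists_algebraMap_of_central hσ hy b hspan)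
  rw [Module.finrank_eq_card_basis B]
  simp [σ.orderOf_eq_finrank hσ, sq]

theorem norm_root {F : Polynomial K} (hF : F.Monic) (hirr : Irreducible F) :
    Algebra.norm K (AdjoinRoot.root F) = (-1) ^ F.natDegree * F.coeff 0 := by
  have : Fact (Irreducible F) := ⟨hirr⟩
  let pb := AdjoinRoot.powerBasis hF.ne_zero
  have hgen : pb.gen = AdjoinRoot.root F := rfl
  have hdim : pb.dim = F.natDegree := rfl
  rw [← hgen, Algebra.PowerBasis.norm_gen_eq_coeff_zero_minpoly, hgen, hdim,
    AdjoinRoot.minpoly_root hF.ne_zero, hF.leadingCoeff]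
  simp

end SkewPolyRing

/-! ### The main theorem. -/

/-- Let `L/K` be a cyclic Galois extension of degree `n` with Galois group generated by `σ`,
`R = L[x;σ]`, `F ∈ K[y]` monic irreducible of degree `s`, `E = K[y]/(F)`, `R_F = R / R F(xⁿ)`.
If `K` is finite and `F ≠ y` then `R_F` is isomorphic to `M_n(E)`. For every `K` and every
isomorphism `R_F ≃ M_n(E)`, a nonzero `a` of degree at most `sk` has rank at least `n - k`, and in
case of equality `N(a₀) / N(a_{sk}) = (-1)^{sk(n-1)} F₀ᵏ`. -/
theorem mainTheorem9 {K L : Type*} [Field K] [Field L] [Algebra K L] [FiniteDimensional K L]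
    [IsGalois K L] (n : ℕ) (hn : Module.finrank K L = n)
    (σ : L ≃ₐ[K] L) (hσ : ∀ τ : L ≃ₐ[K] L, τ ∈ Subgroup.zpowers σ)
    (F : Polynomial K) (hFmonic : F.Monic) (hFirr : Irreducible F)
    (s : ℕ) (hs : F.natDegree = s) :
    (Finite K → F ≠ Polynomial.X → Nonempty (SkewPolyRing.QuotRing σ F ≃ₐ[AdjoinRoot F]
        Matrix (Fin n) (Fin n) (AdjoinRoot F))) ∧
    ∀ (φ : SkewPolyRing.QuotRing σ F ≃ₐ[AdjoinRoot F] Matrix (Fin n) (Fin n) (AdjoinRoot F))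
      (k : ℕ) (a : SkewPolyRing σ), a ≠ 0 → a.degree ≤ ((s * k : ℕ) : WithBot ℕ) →
        n ≤ (φ (SkewPolyRing.toQuot σ F a)).rank + k ∧
        ((φ (SkewPolyRing.toQuot σ F a)).rank + k = n →
          a.coeff (s * k) ≠ 0 ∧
          Algebra.norm K (a.coeff 0) / Algebra.norm K (a.coeff (s * k))
            = (-1) ^ (s * k * (n - 1)) * F.coeff 0 ^ k) := by
  refine ⟨fun _ hFX => by
    subst hn; exact SkewPolyRing.nonempty_algEquiv_matrix σ hσ hFmonic hFirr hFX, ?_⟩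
  intro φ k a ha hdeg
  have : Fact (Irreducible F) := ⟨hFirr⟩
  have : Module.Finite K (AdjoinRoot F) := (AdjoinRoot.powerBasis hFirr.ne_zero).finite
  have hE : Module.finrank K (AdjoinRoot F) = s := by
    rw [(AdjoinRoot.powerBasis hFirr.ne_zero).finrank, AdjoinRoot.powerBasis_dim, hs]
  have hspos : 0 < s := hs ▸ hFirr.natDegree_pos
  have hnpos : 0 < n := hn ▸ Module.finrank_pos
  have hp := SkewPolyRing.isCyclicPair σ φ.toAlgHom
  have hne : (SkewPolynomial.support (R := L) a).Nonempty :=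
    Finset.nonempty_iff_ne_empty.2 fun h => ha (SkewPolynomial.support_eq_empty.1 h)
  let d := (SkewPolynomial.support (R := L) a).max' hne
  have had : a.coeff d ≠ 0 := SkewPolynomial.mem_support_iff.1 (Finset.max'_mem _ hne)
  have hmax : ∀ i, d < i → a.coeff i = 0 := fun i hi => by
    by_contra h
    exact absurd (Finset.le_max' _ i (SkewPolynomial.mem_support_iff.2 h)) (not_le.2 hi)
  have hdle : d ≤ s * k := by
    have h : ((d : ℕ) : WithBot ℕ) ≤ ((s * k : ℕ) : WithBot ℕ) := by
      refine le_trans (le_of_eq ?_) hdeg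
      exact Finset.coe_max' hne
    exact_mod_cast h
  have himage : φ (SkewPolyRing.toQuot σ F a) = ∑ i ∈ Finset.range (d + 1),
      φ (SkewPolyRing.toQuot σ F (SkewPolyRing.C σ (a.coeff i))) *
        φ (SkewPolyRing.toQuot σ F (SkewPolyRing.X σ)) ^ i := by
    conv_lhs => rw [SkewPolyRing.sum_C_coeff_mul_X_pow σ a hmax]
    simp only [map_sum, map_mul, map_pow]
  obtain ⟨k', hk', hle, heq⟩ := hp.rank_bound hσ hn (by
    intro M
    obtain ⟨w, rfl⟩ := φ.surjective M
    obtain ⟨b, rfl⟩ := Ideal.Quotient.mk_surjective w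
    let g : SkewPolyRing σ →+ Matrix (Fin n) (Fin n) (AdjoinRoot F) :=
      ((φ : SkewPolyRing.QuotRing σ F →+* _).comp (SkewPolyRing.toQuot σ F)).toAddMonoidHom
    have h := AddSubmonoid.mem_map_of_mem g (SkewPolyRing.mem_closure_C_mul_X_pow σ b)
    rw [AddMonoidHom.map_mclosure] at h
    refine AddSubmonoid.closure_mono ?_ h
    rintro _ ⟨_, ⟨l, i, rfl⟩, rfl⟩
    refine ⟨l, i, ?_⟩
    change _ = φ (SkewPolyRing.toQuot σ F (SkewPolyRing.C σ l * SkewPolyRing.X σ ^ i))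
    simp only [map_mul, map_pow]
    rfl) had
  have hrank : (φ (SkewPolyRing.toQuot σ F a)).rank + k' = n := by
    rw [himage]; exact hk'
  rw [hE] at hle heq
  have hkk : k' ≤ k := Nat.le_of_mul_le_mul_left (hle.trans hdle) hspos
  refine ⟨by omega, fun hr => ?_⟩
  have hkeq : k' = k := by omega
  subst hkeq
  -- Equality of ranks squeezes the true degree `d` to `s * k'`, so the coefficient there is the
  -- leading one.
  have hd : s * k' = d := le_antisymm hle hdle
  have h := heq hd
  rw [hd]
  refine ⟨had, ?_⟩
  have hdiv : Algebra.norm K (a.coeff 0) / Algebra.norm K (a.coeff d) =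
      Algebra.norm K (a.coeff 0 / a.coeff d) := by
    rw [div_eq_iff (Algebra.norm_ne_zero_iff.2 had), ← map_mul, div_mul_cancel₀ _ had]
  rw [hdiv]
  have hneg : ∀ m : ℕ, Algebra.norm K ((-1 : L) ^ m) = ((-1) ^ n) ^ m := by
    intro m
    have h1 : (-1 : L) = algebraMap K L (-1) := by simp
    rw [map_pow, h1, Algebra.norm_algebraMap, hn]
  have hneg' : ∀ m : ℕ, Algebra.norm K ((-1 : AdjoinRoot F) ^ m) = ((-1) ^ s) ^ m := by
    intro m
    have h1 : (-1 : AdjoinRoot F) = algebraMap K (AdjoinRoot F) (-1) := by simp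
    rw [map_pow, h1, Algebra.norm_algebraMap, hE]
  rw [map_mul, hneg, mul_pow, map_mul, map_pow _ (AdjoinRoot.root F),
    SkewPolyRing.norm_root hFmonic hFirr, hs, ← pow_mul (-1 : AdjoinRoot F), hneg'] at h
  obtain ⟨m, rfl⟩ := Nat.exists_eq_succ_of_ne_zero hnpos.ne'
  simp only [Nat.succ_eq_add_one, Nat.add_sub_cancel] at h ⊢
  rw [← hd] at h ⊢
  generalize Algebra.norm K (a.coeff 0 / _) = N at h ⊢
  -- Only signs remain, with `n = m + 1`: both `δ` and `ε` square to 1.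
  have hδ : ((-1 : K) ^ (s * k' * m)) * (-1) ^ (s * k' * m) = 1 := by
    rw [← mul_pow]; simp
  have hε : ((-1 : K) ^ (s * k')) * (-1) ^ (s * k') = 1 := by
    rw [← mul_pow]; simp
  have h1 : (-1 : K) ^ (s * k' * m) * (-1) ^ (s * k') * N * (-1) ^ (s * k' * m) =
      (-1) ^ (s * k' * m) * (-1) ^ (s * k') * F.coeff 0 ^ k' := by
    convert h using 1 <;> ring
  generalize (-1 : K) ^ (s * k' * m) = δ at h1 hδ ⊢
  generalize (-1 : K) ^ (s * k') = ε at h1 hε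
  linear_combination ε * h1 - δ ^ 2 * N * hε - N * hδ + δ * F.coeff 0 ^ k' * hε
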